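/- Let $(M,\hat g,I_1,I_2,I_3)$ be an HKT manifold: $M$ is a smooth manifold, $\hat g$ a smooth Riemannian metric, $I_1,I_2,I_3$ are integrable complex structures with $I_1^2=I_2^2=I_3^2=-\mathrm{id}$, $I_1I_2=I_3=-I_2I_1$ and $\hat g(I_rX,I_rY)=\hat g(X,Y)$, and there is a (necessarily unique) linear connection $D$, the HKT connection, with $D\hat g=0$, $DI_1=DI_2=DI_3=0$ and such that $c(X,Y,Z)=\hat g(T^D(X,Y),Z)$ is a $3$-form, where $T^D$ is the torsion of $D$. Write $\hat F_r(X,Y)=\hat g(I_rX,Y)$. For a $k$-form $\omega$ let $(I_r\omega)(X_1,\dots,X_k)=(-1)^k\omega(I_rX_1,\dots,I_rX_k)$, $\omega_r:=I_r\omega$ and $d_r\omega=(-1)^kI_r\,d\,I_r\omega$. A (smooth) $1$-form $\omega$ is a potential $1$-form if $$\hat F_1=\tfrac12(d\omega_1+d_2\omega_3),\quad \hat F_2=\tfrac12(d\omega_2+d_3\omega_1),\quad \hat F_3=\tfrac12(d\omega_3+d_1\omega_2).$$ Let $\hat\theta$ be a $1$-form such that $-2\hat\theta$ is a closed potential $1$-form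 and is parallel with respect to $D$, and let $V$ be the vector field with $\hat g(V,\cdot)=\hat\theta$. Then $V$ and $I_1V,I_2V,I_3V$ are Killing vector fields and the $I_rV$ rotate the complex structures: $$\mathcal L_V\hat g=0,\qquad \mathcal L_{I_rV}\hat g=0,\qquad \mathcal L_{I_rV}I_s=\sum_{t=1}^{3}\epsilon^{rst}I_t\qquad (r,s\in\{1,2,3\}),$$ where $\epsilon^{rst}$ is the Levi-Civita symbol. As the dual $1$-form $\hat\theta$ of $V$ is moreover closed, this says that $V$ is a $D(2,1;-1)$-symmetry of the HKT manifold. -/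

import Mathlib

open Bundle VectorField
open scoped Manifold ContDiff

noncomputable section

namespace HKT

variable {n : ℕ} {M : Type*} [TopologicalSpace M]
  [ChartedSpace (EuclideanSpace ℝ (Fin n)) M] [IsManifold (𝓡 n) ∞ M]

/-! ### Vector fields, 1-forms, endomorphism fields -/

variable (n M) in
/-- (Not necessarily smooth) vector fields on `M`. -/
abbrev VField : Type _ := Π x : M, TangentSpace (𝓡 n) x

variable (n M) in
/-- (Not necessarily smooth) 1-forms on `M`. -/
abbrev OneForm : Type _ := Π x : M, TangentSpace (𝓡 n) x →L[ℝ] ℝ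

variable (n M) in
/-- (Not necessarily smooth) fields of endomorphisms of the tangent bundle of `M`. -/
abbrev EndoField : Type _ :=
  Π x : M, TangentSpace (𝓡 n) x →L[ℝ] TangentSpace (𝓡 n) x

variable (n M) in
/-- Smooth Riemannian metrics on `M`. -/
abbrev Metric : Type _ :=
  ContMDiffRiemannianMetric (𝓡 n) ∞ (EuclideanSpace ℝ (Fin n))
    (fun x : M ↦ TangentSpace (𝓡 n) x)

variable (n M) in
/-- Linear connections on `M`; `D Y x v` is the derivative of `Y` at `x` in the direction `v`. -/
abbrev Connection : Type _ :=
  CovariantDerivative (𝓡 n) (EuclideanSpace ℝ (Fin n)) (fun x : M ↦ TangentSpace (𝓡 n) x)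

/-- `X` is a smooth section of `TM`. -/
def SmoothVField (X : VField n M) : Prop :=
  ContMDiff (𝓡 n) ((𝓡 n).prod 𝓘(ℝ, EuclideanSpace ℝ (Fin n))) ∞
    (fun x ↦ TotalSpace.mk' (EuclideanSpace ℝ (Fin n))
      (E := fun x : M ↦ TangentSpace (𝓡 n) x) x (X x))

/-- `α` is a smooth section of `T*M`. -/
def SmoothOneForm (α : OneForm n M) : Prop :=
  ContMDiff (𝓡 n) ((𝓡 n).prod 𝓘(ℝ, EuclideanSpace ℝ (Fin n) →L[ℝ] ℝ)) ∞
    (fun x ↦ TotalSpace.mk' (EuclideanSpace ℝ (Fin n) →L[ℝ] ℝ)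
      (E := fun x : M ↦ TangentSpace (𝓡 n) x →L[ℝ] ℝ) x (α x))

/-- `J` is a smooth section of `End(TM)`. -/
def SmoothEndoField (J : EndoField n M) : Prop :=
  ContMDiff (𝓡 n)
    ((𝓡 n).prod 𝓘(ℝ, EuclideanSpace ℝ (Fin n) →L[ℝ] EuclideanSpace ℝ (Fin n))) ∞
    (fun x ↦ TotalSpace.mk' (EuclideanSpace ℝ (Fin n) →L[ℝ] EuclideanSpace ℝ (Fin n))
      (E := fun x : M ↦ TangentSpace (𝓡 n) x →L[ℝ] TangentSpace (𝓡 n) x) x (J x))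

/-- The vector field `J X`. -/
def EndoField.app (J : EndoField n M) (X : VField n M) : VField n M := fun x ↦ J x (X x)

/-- The derivative `X f` of a function `f` along a vector field `X`. -/
def dirDeriv (X : VField n M) (f : M → ℝ) : M → ℝ := fun x ↦ mvfderiv (𝓡 n) f x (X x)

/-- The Lie bracket `[X, Y]`. -/
def bracket (X Y : VField n M) : VField n M := mlieBracket (𝓡 n) X Y

/-- The function `g(X, Y)`. -/
def Metric.app (g : Metric n M) (X Y : VField n M) : M → ℝ := fun x ↦ g.inner x (X x) (Y x)

/-- The function `α(X)`. -/
def OneForm.app (α : OneForm n M) (X : VField n M) : M → ℝ := fun x ↦ α x (X x)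

/-! ### Exterior and Lie derivatives -/

/-- The exterior derivative of a 1-form, evaluated on two (smooth) vector fields:
`dα(X, Y) = X(α(Y)) - Y(α(X)) - α([X, Y])`. -/
def extD (α : OneForm n M) (X Y : VField n M) : M → ℝ :=
  dirDeriv X (α.app Y) - dirDeriv Y (α.app X) - α.app (bracket X Y)

/-- `dα = 0`. -/
def ClosedOneForm (α : OneForm n M) : Prop :=
  ∀ X Y : VField n M, SmoothVField X → SmoothVField Y → extD α X Y = 0

/-- The action of `J` on 1-forms, `(J α)(X) = -α(J X)`. -/
def twist (J : EndoField n M) (α : OneForm n M) : OneForm n M := fun x ↦ -((α x).comp (J x))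

/-- The twisted derivative `d_J α = -J d J α` of a 1-form, where `J` acts on 2-forms by
`(J β)(X, Y) = β(J X, J Y)`. -/
def twistedD (J : EndoField n M) (α : OneForm n M) (X Y : VField n M) : M → ℝ :=
  -extD (twist J α) (J.app X) (J.app Y)

/-- `(L_W g)(X, Y) = W(g(X, Y)) - g([W, X], Y) - g(X, [W, Y])`. -/
def lieMetric (W : VField n M) (g : Metric n M) (X Y : VField n M) : M → ℝ :=
  dirDeriv W (Metric.app g X Y) - Metric.app g (bracket W X) Y - Metric.app g X (bracket W Y)

/-- `(L_W J)(X) = [W, J X] - J [W, X]`. -/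
def lieEndo (W : VField n M) (J : EndoField n M) (X : VField n M) : VField n M :=
  bracket W (J.app X) - J.app (bracket W X)

/-- `W` is a Killing vector field of `g`: it is smooth and `L_W g = 0`. -/
def IsKilling (g : Metric n M) (W : VField n M) : Prop :=
  SmoothVField W ∧
    ∀ X Y : VField n M, SmoothVField X → SmoothVField Y → lieMetric W g X Y = 0

/-! ### Hyperhermitian structures and HKT connections -/

/-- `J` is an integrable complex structure: a smooth endomorphism field with `J² = -id` and
vanishing Nijenhuis tensor `[JX, JY] - J[JX, Y] - J[X, JY] - [X, Y]`. -/
structure IsComplexStructure (J : EndoField n M) : Prop where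
  smooth : SmoothEndoField J
  sq : ∀ (x : M) (v : TangentSpace (𝓡 n) x), J x (J x v) = -v
  integrable : ∀ X Y : VField n M, SmoothVField X → SmoothVField Y →
    bracket (J.app X) (J.app Y) - J.app (bracket (J.app X) Y) - J.app (bracket X (J.app Y))
      - bracket X Y = 0

/-- `(g, J 0, J 1, J 2)` is a hyperhermitian structure; `J 0, J 1, J 2` stand for
`I₁, I₂, I₃`. -/
structure IsHyperhermitian (g : Metric n M) (J : Fin 3 → EndoField n M) : Prop where
  complex : ∀ r, IsComplexStructure (J r)
  mul₁₂ : ∀ (x : M) (v : TangentSpace (𝓡 n) x), J 0 x (J 1 x v) = J 2 x v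
  mul₂₁ : ∀ (x : M) (v : TangentSpace (𝓡 n) x), J 1 x (J 0 x v) = -J 2 x v
  hermitian : ∀ (r : Fin 3) (x : M) (v w : TangentSpace (𝓡 n) x),
    g.inner x (J r x v) (J r x w) = g.inner x v w

/-- The fundamental 2-form `F_J(X, Y) = g(J X, Y)`. -/
def fundForm (g : Metric n M) (J : EndoField n M) (X Y : VField n M) : M → ℝ :=
  Metric.app g (J.app X) Y

/-- `D` is an HKT connection of `(g, J 0, J 1, J 2)`: `D g = 0`, `D (J r) = 0`, and
`c(X, Y, Z) = g(T(X, Y), Z)` is a 3-form, where `T` is the torsion of `D`. (Such a `D` is unique,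
hence smooth, so smoothness of `D` and `c` is not asked for separately.) -/
structure IsHKTConnection (g : Metric n M) (J : Fin 3 → EndoField n M)
    (D : Connection n M) : Prop where
  metric : ∀ X Y : VField n M, SmoothVField X → SmoothVField Y →
    ∀ (x : M) (v : TangentSpace (𝓡 n) x),
      mvfderiv (𝓡 n) (Metric.app g X Y) x v
        = g.inner x (D X x v) (Y x) + g.inner x (X x) (D Y x v)
  parallel : ∀ (r : Fin 3) (X : VField n M), SmoothVField X →
    ∀ (x : M) (v : TangentSpace (𝓡 n) x), D ((J r).app X) x v = J r x (D X x v)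
  torsion_alternating : ∀ x : M,
    ∃ c : AlternatingMap ℝ (TangentSpace (𝓡 n) x) ℝ (Fin 3),
      ∀ u v w : TangentSpace (𝓡 n) x, c ![u, v, w] = g.inner x (D.torsion x u v) w

/-- `(M, g, J)` is an HKT structure and `D` is its HKT connection. -/
structure IsHKT (g : Metric n M) (J : Fin 3 → EndoField n M) (D : Connection n M) : Prop where
  hyperhermitian : IsHyperhermitian g J
  connection : IsHKTConnection g J D

/-- `D α = 0`, i.e. `v(α(Y)) = α(D_v Y)`. -/
def ParallelOneForm (D : Connection n M) (α : OneForm n M) : Prop :=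
  ∀ Y : VField n M, SmoothVField Y → ∀ (x : M) (v : TangentSpace (𝓡 n) x),
    mvfderiv (𝓡 n) (α.app Y) x v - α x (D Y x v) = 0

/-- `η` is a potential 1-form of the HKT structure: it is smooth and, with `η_r = J_r η`,
`F_r = (1/2) (dη_r + d_{r+1} η_{r+2})`, indices being taken cyclically. -/
def IsPotentialOneForm (g : Metric n M) (J : Fin 3 → EndoField n M) (η : OneForm n M) : Prop :=
  SmoothOneForm η ∧
    ∀ (r : Fin 3) (X Y : VField n M), SmoothVField X → SmoothVField Y →
      fundForm g (J r) X Y = (1 / 2 : ℝ) •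
        (extD (twist (J r) η) X Y + twistedD (J (r + 1)) (twist (J (r + 2)) η) X Y)

/-- The dual 1-form `g(V, ·)` of a vector field `V`. -/
def flat (g : Metric n M) (V : VField n M) : OneForm n M := fun x ↦ g.inner x (V x)

/-- The Levi-Civita symbol `ε^{rst}`. -/
def eps (r s t : Fin 3) : ℝ :=
  if s = r + 1 ∧ t = r + 2 then 1 else if s = r + 2 ∧ t = r + 1 then -1 else 0

end HKT

end

namespace HKT

/-! ### Cyclic evaluation of the Levi-Civita sums. -/

section LeviCivita

variable {E : Type*} [AddCommGroup E] [Module ℝ E]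

/-! For a `D`-parallel field `W`, write `T_W = T(W, ·)`. Then `L_W = D_W - T_W`. Since `Dg = 0` and
`T` is totally skew, `W` is Killing (`isKilling_of_parallel`); since `DJ = 0`, `L_W J = [J, T_W]`
(`lieEndo_of_parallel`). Both apply to `V` and to every `I_r V`, because `Dg = 0` and `DI_r = 0`
carry parallelism over from `θ`.

It remains to compute commutators with `T_W` for `W = I_r V`. Closedness of `θ` forces `T_V = 0`, so
`L_V I_r = 0`, and integrability upgrades this to `L_W I_r = 0`. For parallel 1-forms `dα = α ∘ T`,
so the potential equation becomes algebraic (`apply_eq_torsion`) and yields `[I_{r+1}, T_W] =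
I_{r+2}`. The case of `I_{r+2} = I_r I_{r+1}` follows because `T_W` commutes with `I_r`. -/

lemma sum_eps_self_smul (r : Fin 3) (f : Fin 3 → E) :
    ∑ t, eps r r t • f t = 0 := by
  fin_cases r <;> simp [eps]

lemma sum_eps_add_one_smul (r : Fin 3) (f : Fin 3 → E) :
    ∑ t, eps r (r + 1) t • f t = f (r + 2) := by
  fin_cases r <;> simp [eps]

lemma sum_eps_add_two_smul (r : Fin 3) (f : Fin 3 → E) :
    ∑ t, eps r (r + 2) t • f t = -f (r + 1) := by
  fin_cases r <;> simp [eps]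

end LeviCivita

variable {n : ℕ} {M : Type*} [TopologicalSpace M]
  [ChartedSpace (EuclideanSpace ℝ (Fin n)) M] [IsManifold (𝓡 n) ∞ M]

/-! ### Smooth sections and extension of tangent vectors. -/

section Smoothness

lemma SmoothVField.mdifferentiableAt {X : VField n M} (hX : SmoothVField X) (x : M) :
    MDifferentiableAt (𝓡 n) ((𝓡 n).prod 𝓘(ℝ, EuclideanSpace ℝ (Fin n)))
      (fun x ↦ TotalSpace.mk' (EuclideanSpace ℝ (Fin n))
        (E := fun x : M ↦ TangentSpace (𝓡 n) x) x (X x)) x :=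
  (ContMDiff.mdifferentiable hX (by simp)) x

lemma SmoothEndoField.app {J : EndoField n M} (hJ : SmoothEndoField J) {X : VField n M}
    (hX : SmoothVField X) : SmoothVField (J.app X) :=
  ContMDiff.clm_bundle_apply (E₁ := fun x : M ↦ TangentSpace (𝓡 n) x)
    (E₂ := fun x : M ↦ TangentSpace (𝓡 n) x) hJ hX

lemma SmoothOneForm.const_smul {α : OneForm n M} (hα : SmoothOneForm α) (a : ℝ) :
    SmoothOneForm (a • α) :=
  ContMDiff.const_smul_section (V := fun x : M ↦ TangentSpace (𝓡 n) x →L[ℝ] ℝ) hα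

/-- On a Hausdorff manifold every tangent vector extends to a smooth vector field. -/
lemma exists_smoothVField_eq [T2Space M] (x : M) (v : TangentSpace (𝓡 n) x) :
    ∃ X : VField n M, SmoothVField X ∧ X x = v := by
  obtain ⟨s, hs, hsmooth⟩ := FiberBundle.exists_contMDiffOn_extend (k := ∞) (𝓡 n)
    (EuclideanSpace ℝ (Fin n)) (V := fun x : M ↦ TangentSpace (𝓡 n) x) v
  -- The local extension is smooth only near `x`; a bump function supported there makes it global.
  obtain ⟨f, -, hf⟩ := (SmoothBumpFunction.nhds_basis_tsupport (I := 𝓡 n) x).mem_iff.1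
    (interior_mem_nhds.2 hs)
  refine ⟨fun y ↦ f y • FiberBundle.extend (EuclideanSpace ℝ (Fin n))
    (E := fun x : M ↦ TangentSpace (𝓡 n) x) v y, ?_, ?_⟩
  · exact ContMDiffOn.smul_section_of_tsupport (V := fun x : M ↦ TangentSpace (𝓡 n) x)
      f.contMDiff.contMDiffOn isOpen_interior hf (hsmooth.mono interior_subset)
  · simp

end Smoothness

/-! ### Nondegeneracy and raising indices. -/

section Metric

lemma Metric.eq_of_inner_left (g : Metric n M) {x : M} {u v : TangentSpace (𝓡 n) x}
    (h : ∀ w, g.inner x u w = g.inner x v w) : u = v := by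
  by_contra hne
  have hpos := g.pos x (u - v) (sub_ne_zero.2 hne)
  have heq : g.inner x (u - v) = 0 := by
    rw [map_sub, sub_eq_zero]
    exact ContinuousLinearMap.ext h
  rw [heq] at hpos
  exact lt_irrefl _ hpos

/-- The metric dual of a smooth 1-form is smooth. -/
lemma smoothVField_of_flat (g : Metric n M) {V : VField n M} (h : SmoothOneForm (flat g V)) :
    SmoothVField V := by
  intro x₀
  let F := EuclideanSpace ℝ (Fin n)
  let T : M → Type := fun x ↦ TangentSpace (𝓡 n) x
  let t := trivializationAt F T x₀
  -- `G` and `a` are the metric and the 1-form in the trivialization at `x₀`. There `V` has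
  -- coordinates `G⁻¹ a`, and inversion is smooth at invertible operators.
  let G : M → F →L[ℝ] F →L[ℝ] ℝ := fun x ↦
    ContinuousLinearMap.inCoordinates F T (F →L[ℝ] ℝ) (fun x ↦ T x →L[ℝ] ℝ) x₀ x x₀ x (g.inner x)
  let a : M → F →L[ℝ] ℝ := fun x ↦
    ContinuousLinearMap.inCoordinates F T ℝ (Bundle.Trivial M ℝ) x₀ x x₀ x (flat g V x)
  have hG : ContMDiffAt (𝓡 n) 𝓘(ℝ, F →L[ℝ] F →L[ℝ] ℝ) ∞ G x₀ :=
    ((contMDiffAt_hom_bundle _).1 (g.contMDiff x₀)).2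
  have ha : ContMDiffAt (𝓡 n) 𝓘(ℝ, F →L[ℝ] ℝ) ∞ a x₀ :=
    ((contMDiffAt_hom_bundle _).1 (h x₀)).2
  have hGapp : ∀ x ∈ t.baseSet, ∀ u v : F,
      G x u v = g.inner x (t.symmL ℝ x u) (t.symmL ℝ x v) := by
    intro x hx u v
    have hx' : x ∈ (trivializationAt (F →L[ℝ] ℝ) (fun x ↦ T x →L[ℝ] ℝ) x₀).baseSet := by
      rw [hom_trivializationAt_baseSet]
      exact ⟨hx, Set.mem_univ x⟩
    simp only [G, ContinuousLinearMap.inCoordinates, ContinuousLinearMap.comp_apply,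
      Trivialization.continuousLinearMapAt_apply, Trivialization.coe_linearMapAt_of_mem _ hx']
    erw [hom_trivializationAt_apply]
    simp [ContinuousLinearMap.inCoordinates, t]
  have haapp : ∀ x ∈ t.baseSet, ∀ v : F, a x v = g.inner x (V x) (t.symmL ℝ x v) := by
    intro x hx v
    simp [a, ContinuousLinearMap.inCoordinates, flat, t]
  have hinv : ∀ x ∈ t.baseSet, (G x).IsInvertible := by
    intro x hx
    -- Definiteness gives injectivity; equality of dimensions then gives invertibility.
    have hinj : Function.Injective (G x).toLinearMap := by
      intro u v huv
      have := g.eq_of_inner_left (u := t.symmL ℝ x u) (v := t.symmL ℝ x v) fun w ↦ by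
        have hw := congrArg (fun f : F →L[ℝ] ℝ ↦ f (t.continuousLinearMapAt ℝ x w)) huv
        simpa only [hGapp x hx, t.symmL_continuousLinearMapAt hx, ContinuousLinearMap.coe_coe] using hw
      simpa [t.continuousLinearMapAt_symmL hx] using congrArg (t.continuousLinearMapAt ℝ x) this
    have hdim : Module.finrank ℝ F = Module.finrank ℝ (F →L[ℝ] ℝ) := by
      rw [← (LinearMap.toContinuousLinearMap (𝕜 := ℝ) (E := F) (F' := ℝ)).finrank_eq]
      exact (Subspace.dual_finrank_eq).symm
    exact ⟨(LinearEquiv.ofInjectiveOfFinrankEq (G x).toLinearMap hinj hdim).toContinuousLinearEquiv,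
      by ext; rfl⟩
  have hx₀ : x₀ ∈ t.baseSet := FiberBundle.mem_baseSet_trivializationAt' x₀
  rw [contMDiffAt_section]
  have hsmooth : ContMDiffAt (𝓡 n) 𝓘(ℝ, F) ∞ (fun x ↦ (G x).inverse (a x)) x₀ :=
    ((hinv x₀ hx₀).contDiffAt_map_inverse.contMDiffAt.comp x₀ hG).clm_apply ha
  refine hsmooth.congr_of_eventuallyEq ?_
  filter_upwards [t.open_baseSet.mem_nhds hx₀] with x hx
  rw [eq_comm, (hinv x hx).inverse_apply_eq]
  ext v
  rw [haapp x hx, hGapp x hx]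
  have : (t ⟨x, V x⟩).2 = t.continuousLinearMapAt ℝ x (V x) := by
    simp [t.coe_linearMapAt_of_mem hx]
  erw [this]
  rw [t.symmL_continuousLinearMapAt hx]

end Metric

/-! ### Parallel fields and forms: derivatives expressed by the torsion. -/

section HKTConnection

variable {g : Metric n M} {J : Fin 3 → EndoField n M} {D : Connection n M}

lemma bracket_apply (D : Connection n M) {X Y : VField n M} (hX : SmoothVField X)
    (hY : SmoothVField Y) (x : M) :
    bracket X Y x = D Y x (X x) - D X x (Y x) - D.torsion x (X x) (Y x) := by
  rw [D.torsion_apply (hX.mdifferentiableAt x) (hY.mdifferentiableAt x)]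
  exact (sub_sub_cancel _ _).symm

lemma IsHKTConnection.inner_torsion_swap (h : IsHKTConnection g J D) (x : M)
    (u v w : TangentSpace (𝓡 n) x) :
    g.inner x (D.torsion x u v) w = -g.inner x (D.torsion x u w) v := by
  obtain ⟨c, hc⟩ := h.torsion_alternating x
  rw [← hc, ← hc, ← c.map_swap ![u, w, v] (show (1 : Fin 3) ≠ 2 by decide)]
  congr 1
  ext i
  fin_cases i <;> rfl

lemma IsHKTConnection.inner_torsion_rotate (h : IsHKTConnection g J D) (x : M)
    (u v w : TangentSpace (𝓡 n) x) :
    g.inner x (D.torsion x u v) w = g.inner x (D.torsion x v w) u := by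
  rw [D.torsion_antisymm, map_neg, neg_apply, h.inner_torsion_swap, neg_neg]

/-- Metric compatibility cancels the `D`-terms of `L_W g`, leaving `g(T(W, X), Y) + g(X, T(W, Y))`,
which vanishes by skewness of the torsion form. -/
lemma IsHKTConnection.isKilling_of_parallel (h : IsHKTConnection g J D) {W : VField n M}
    (hW : SmoothVField W) (hDW : ∀ x, D W x = 0) : IsKilling g W := by
  refine ⟨hW, fun X Y hX hY ↦ funext fun x ↦ ?_⟩
  have hmet := h.metric X Y hX hY x (W x)
  have hskew := h.inner_torsion_swap x (W x) (X x) (Y x)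
  have hsymm := g.symm x (X x) (D.torsion x (W x) (Y x))
  simp only [lieMetric, dirDeriv, Metric.app, Pi.sub_apply, bracket_apply D hW hX,
    bracket_apply D hW hY, hDW, map_sub, sub_apply, zero_apply, map_zero, Pi.zero_apply] at hmet ⊢
  linarith

lemma IsHKTConnection.lieEndo_of_parallel (h : IsHKTConnection g J D) (hJ : IsHyperhermitian g J)
    {W : VField n M} (hW : SmoothVField W) (hDW : ∀ x, D W x = 0) (s : Fin 3) {X : VField n M}
    (hX : SmoothVField X) (x : M) :
    lieEndo W (J s) X x
      = J s x (D.torsion x (W x) (X x)) - D.torsion x (W x) (J s x (X x)) := by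
  have hJX := (hJ.complex s).smooth.app hX
  simp only [lieEndo, Pi.sub_apply, EndoField.app, bracket_apply D hW hX]
  rw [bracket_apply D hW hJX, h.parallel s X hX]
  simp only [hDW, map_sub, zero_apply, map_zero, EndoField.app]
  abel

/-- The terms `α(D_X Y)` and `α(D_Y X)` cancel against those in `α([X, Y])`, so `dα` becomes
tensorial. -/
lemma ParallelOneForm.extD_apply {α : OneForm n M} (hα : ParallelOneForm D α) {X Y : VField n M}
    (hX : SmoothVField X) (hY : SmoothVField Y) (x : M) :
    extD α X Y x = α x (D.torsion x (X x) (Y x)) := by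
  have h₁ := hα Y hY x (X x)
  have h₂ := hα X hX x (Y x)
  simp only [extD, dirDeriv, Pi.sub_apply]
  rw [sub_eq_zero.1 h₁, sub_eq_zero.1 h₂, OneForm.app, bracket_apply D hX hY, map_sub, map_sub]
  abel

lemma ParallelOneForm.twist (h : IsHKTConnection g J D) (hJ : IsHyperhermitian g J)
    {α : OneForm n M} (hα : ParallelOneForm D α) (r : Fin 3) :
    ParallelOneForm D (twist (J r) α) := by
  intro Y hY x v
  have hJY := hα _ ((hJ.complex r).smooth.app hY) x v
  rw [h.parallel r Y hY] at hJY
  have : (HKT.twist (J r) α).app Y = -(α.app ((J r).app Y)) := rfl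
  rw [this, mvfderiv_neg]
  simp only [HKT.twist, neg_apply, ContinuousLinearMap.comp_apply]
  linarith

lemma IsHKTConnection.parallel_of_flat [T2Space M] (h : IsHKTConnection g J D) {V : VField n M}
    (hV : SmoothVField V) (hα : ParallelOneForm D (flat g V)) (x : M) : D V x = 0 := by
  ext1 v
  refine g.eq_of_inner_left fun w ↦ ?_
  obtain ⟨Y, hY, rfl⟩ := exists_smoothVField_eq x w
  have h₁ := h.metric V Y hV hY x v
  have h₂ := hα Y hY x v
  have h₃ : (flat g V).app Y = Metric.app g V Y := rfl
  rw [h₃, h₁] at h₂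
  simpa [flat] using h₂

end HKTConnection

/-! ### Cyclic quaternion relations. -/

section Quaternions

variable {g : Metric n M} {J : Fin 3 → EndoField n M}

lemma IsHyperhermitian.apply_succ (h : IsHyperhermitian g J) (r : Fin 3) (x : M)
    (v : TangentSpace (𝓡 n) x) : J r x (J (r + 1) x v) = J (r + 2) x v := by
  have hs := fun r ↦ (h.complex r).sq x
  have h₁ := h.mul₁₂ x
  have h₂ := h.mul₂₁ x
  fin_cases r
  · exact h₁ v
  · change J 1 x (J 2 x v) = J 0 x v
    rw [← h₁, h₂, ← h₁, hs, map_neg, neg_neg]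
  · change J 2 x (J 0 x v) = J 1 x v
    rw [← neg_inj, ← h₂, hs, map_neg]

lemma IsHyperhermitian.succ_apply (h : IsHyperhermitian g J) (r : Fin 3) (x : M)
    (v : TangentSpace (𝓡 n) x) : J (r + 1) x (J r x v) = -J (r + 2) x v := by
  have hs := fun r ↦ (h.complex r).sq x
  have h₁ := h.mul₁₂ x
  have h₂ := h.mul₂₁ x
  fin_cases r
  · exact h₂ v
  · change J 2 x (J 1 x v) = -J 0 x v
    rw [← h₁, hs, map_neg]
  · change J 0 x (J 2 x v) = -J 1 x v
    rw [← h₁, hs]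

lemma IsHyperhermitian.inner_apply_left (h : IsHyperhermitian g J) (r : Fin 3) (x : M)
    (v w : TangentSpace (𝓡 n) x) : g.inner x (J r x v) w = -g.inner x v (J r x w) := by
  rw [← h.hermitian r x v (J r x w), (h.complex r).sq, map_neg, neg_neg]

end Quaternions

/-! ### Consequences of closedness, the potential equations and integrability. -/

section Symmetry

variable {g : Metric n M} {J : Fin 3 → EndoField n M} {D : Connection n M} {V : VField n M}

lemma SmoothVField.differentiable_inner (g : Metric n M) {X Y : VField n M} (hX : SmoothVField X)
    (hY : SmoothVField Y) (x : M) : MDifferentiableAt (𝓡 n) 𝓘(ℝ) (Metric.app g X Y) x := by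
  let _ : RiemannianBundle (fun x : M ↦ TangentSpace (𝓡 n) x) := ⟨g.toRiemannianMetric⟩
  exact ((ContMDiff.inner_bundle (n := ∞) (IB := 𝓡 n) (F := EuclideanSpace ℝ (Fin n))
    (E := fun x : M ↦ TangentSpace (𝓡 n) x) (b := id) hX hY).mdifferentiable (by simp)) x

lemma ParallelOneForm.of_const_smul {a : ℝ} (ha : a ≠ 0) (hV : SmoothVField V)
    (h : ParallelOneForm D (a • flat g V)) : ParallelOneForm D (flat g V) := by
  intro Y hY x v
  have h₁ := h Y hY x v
  have h₂ : (a • flat g V).app Y = (fun _ : M ↦ a) • Metric.app g V Y := rfl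
  rw [h₂, mvfderiv_smul mdifferentiableAt_const (hV.differentiable_inner g hY x),
    mvfderiv_const] at h₁
  have h₃ : a * (mvfderiv (𝓡 n) (Metric.app g V Y) x v - flat g V x (D Y x v)) = 0 := by
    simpa [mul_sub] using h₁
  exact (mul_eq_zero.1 h₃).resolve_left ha

/-- A parallel vector field whose dual 1-form is closed inserts trivially into the torsion. -/
lemma IsHKTConnection.torsion_eq_zero_of_closed [T2Space M] (h : IsHKTConnection g J D)
    (hα : ParallelOneForm D (flat g V)) (hclosed : ClosedOneForm (flat g V)) (x : M)
    (u : TangentSpace (𝓡 n) x) : D.torsion x (V x) u = 0 := by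
  refine g.eq_of_inner_left fun w ↦ ?_
  obtain ⟨X, hX, rfl⟩ := exists_smoothVField_eq x u
  obtain ⟨Y, hY, rfl⟩ := exists_smoothVField_eq x w
  have h₁ := congrFun (hclosed X Y hX hY) x
  rw [hα.extD_apply hX hY, flat, g.symm] at h₁
  rw [h.inner_torsion_rotate, h₁, map_zero]
  rfl

/-- The potential equations in terms of the torsion. -/
lemma IsHKT.apply_eq_torsion [T2Space M] (h : IsHKT g J D)
    (hpot : IsPotentialOneForm g J ((-2 : ℝ) • flat g V))
    (hα : ParallelOneForm D ((-2 : ℝ) • flat g V)) (r : Fin 3) (x : M)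
    (u : TangentSpace (𝓡 n) x) :
    J r x u = -D.torsion x (J r x (V x)) u
      - J (r + 1) x (D.torsion x (J r x (V x)) (J (r + 1) x u)) := by
  refine g.eq_of_inner_left fun w ↦ ?_
  obtain ⟨X, hX, rfl⟩ := exists_smoothVField_eq x u
  obtain ⟨Y, hY, rfl⟩ := exists_smoothVField_eq x w
  have hJ := h.hyperhermitian
  have hD := h.connection
  have key := congrFun (hpot.2 r X Y hX hY) x
  have hJs := (hJ.complex (r + 1)).smooth
  simp only [fundForm, Metric.app, EndoField.app, Pi.smul_apply, Pi.add_apply, twistedD,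
    Pi.neg_apply, (hα.twist hD hJ r).extD_apply hX hY,
    ((hα.twist hD hJ (r + 2)).twist hD hJ (r + 1)).extD_apply (hJs.app hX) (hJs.app hY)] at key
  simp only [twist, flat, Pi.smul_apply, neg_apply, ContinuousLinearMap.comp_apply, smul_apply,
    smul_eq_mul, neg_neg] at key
  -- This turns the doubly twisted form `J_{r+1} J_{r+2} η` into `J_r η`, so both terms of the
  -- potential equation involve the same 1-form.
  have hmul : ∀ v, J (r + 2) x (J (r + 1) x v) = -J r x v := by
    intro v
    have h₁ := hJ.succ_apply (r + 1) x v
    rwa [(by decide : ∀ r : Fin 3, r + 1 + 1 = r + 2), (by decide : ∀ r : Fin 3, r + 1 + 2 = r)]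
      at h₁
  rw [hmul, map_neg] at key
  have hW : ∀ v, g.inner x (V x) (J r x v) = -g.inner x v (J r x (V x)) := fun v ↦ by
    rw [g.symm, hJ.inner_apply_left]
  -- Total skewness moves `J r V` from the last slot of the torsion form to the first; the factor
  -- `-2` absorbs the `1/2`.
  rw [hW, hW, ← hD.inner_torsion_rotate x (J r x (V x)),
    ← hD.inner_torsion_rotate x (J r x (V x))] at key
  rw [key, map_sub, map_neg, sub_apply, neg_apply, hJ.inner_apply_left]
  ring

/-- Integrability of `J`, combined with `L_V J = 0`, gives `L_{JV} J = 0`. -/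
lemma lieEndo_app_self {I : EndoField n M} (hI : IsComplexStructure I) (hV : SmoothVField V)
    (hL : ∀ X, SmoothVField X → lieEndo V I X = 0) {X : VField n M} (hX : SmoothVField X) :
    lieEndo (I.app V) I X = 0 := by
  funext x
  have h₁ := congrFun (hI.integrable V X hV hX) x
  have h₂ := congrFun (hL X hX) x
  simp only [lieEndo, EndoField.app, Pi.sub_apply, Pi.zero_apply] at h₁ h₂ ⊢
  rw [sub_eq_zero.1 h₂, hI.sq, sub_neg_eq_add] at h₁
  rwa [add_sub_cancel_right] at h₁

end Symmetry

end HKT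

/-- Let `(M, g, I₁, I₂, I₃)` be an HKT manifold with HKT connection `D`, and `θ` a 1-form such that
`-2θ` is a closed potential 1-form and is parallel for `D`. If `V` is the `g`-dual of `θ`, then
`V` and all `I_r V` are Killing fields, `L_{I_r V} I_s = ε^{rst} I_t`, and the dual
1-form of `V` is closed; that is, `V` is a `D(2,1;-1)`-symmetry. -/
theorem mainTheorem1 {n : ℕ} {M : Type*} [TopologicalSpace M] [T2Space M]
    [ChartedSpace (EuclideanSpace ℝ (Fin n)) M] [IsManifold (𝓡 n) ∞ M]
    (g : HKT.Metric n M) (J : Fin 3 → HKT.EndoField n M) (D : HKT.Connection n M)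
    (hHKT : HKT.IsHKT g J D)
    (θ : HKT.OneForm n M)
    (hpot : HKT.IsPotentialOneForm g J ((-2 : ℝ) • θ))
    (hclosed : HKT.ClosedOneForm ((-2 : ℝ) • θ))
    (hparallel : HKT.ParallelOneForm D ((-2 : ℝ) • θ))
    (V : HKT.VField n M) (hV : HKT.flat g V = θ) :
    HKT.IsKilling g V ∧
    (∀ r : Fin 3, HKT.IsKilling g ((J r).app V)) ∧
    (∀ (r s : Fin 3) (X : HKT.VField n M), HKT.SmoothVField X →
      HKT.lieEndo ((J r).app V) (J s) X = ∑ t : Fin 3, HKT.eps r s t • (J t).app X) ∧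
    HKT.ClosedOneForm (HKT.flat g V) := by
  subst hV
  have hJ := hHKT.hyperhermitian
  have hD := hHKT.connection
  have hVsmooth : HKT.SmoothVField V := by
    refine HKT.smoothVField_of_flat g ?_
    have := hpot.1.const_smul (-1 / 2)
    rwa [smul_smul, show (-1 / 2 : ℝ) * -2 = 1 by norm_num, one_smul] at this
  have hα := HKT.ParallelOneForm.of_const_smul (by norm_num) hVsmooth hparallel
  have hflat : HKT.ClosedOneForm (HKT.flat g V) := by
    intro X Y hX hY
    funext x
    have h := congrFun (hclosed X Y hX hY) x
    -- Both exterior derivatives are pointwise linear in the form, so the factor `-2` cancels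
    -- without differentiating.
    rw [hparallel.extD_apply hX hY] at h
    rw [hα.extD_apply hX hY]
    simpa using h
  have hDV := hD.parallel_of_flat hVsmooth hα
  have hWsmooth : ∀ r, HKT.SmoothVField ((J r).app V) := fun r ↦
    (hJ.complex r).smooth.app hVsmooth
  have hDW : ∀ r x, D ((J r).app V) x = 0 := by
    intro r x
    ext1 v
    rw [hD.parallel r V hVsmooth, hDV]
    simp
  have hT := hD.torsion_eq_zero_of_closed hα hflat
  refine ⟨hD.isKilling_of_parallel hVsmooth hDV,
    fun r ↦ hD.isKilling_of_parallel (hWsmooth r) (hDW r), fun r s X hX ↦ ?_, hflat⟩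
  have hself : ∀ Y, HKT.SmoothVField Y → HKT.lieEndo ((J r).app V) (J r) Y = 0 := fun Y hY ↦
    HKT.lieEndo_app_self (hJ.complex r) hVsmooth (fun Z hZ ↦ funext fun x ↦ by
      rw [hD.lieEndo_of_parallel hJ hVsmooth hDV r hZ, hT, hT]; simp) hY
  have hself' : ∀ x (u : TangentSpace (𝓡 n) x),
      D.torsion x (J r x (V x)) (J r x u) = J r x (D.torsion x (J r x (V x)) u) := by
    intro x u
    obtain ⟨Y, hY, rfl⟩ := HKT.exists_smoothVField_eq x u
    have h := congrFun (hself Y hY) x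
    rw [hD.lieEndo_of_parallel hJ (hWsmooth r) (hDW r) r hY] at h
    exact (sub_eq_zero.1 h).symm
  have hsucc : ∀ x (u : TangentSpace (𝓡 n) x),
      J (r + 1) x (D.torsion x (J r x (V x)) u) - D.torsion x (J r x (V x)) (J (r + 1) x u)
        = J (r + 2) x u := by
    intro x u
    -- Applying `J (r + 1)` to the algebraic potential equation turns it into a commutator, as `J (r
    -- + 1)` squares to `-1`.
    have h := congrArg (J (r + 1) x) (hHKT.apply_eq_torsion hpot hparallel r x u)
    rw [hJ.succ_apply, map_sub, map_neg, (hJ.complex (r + 1)).sq, sub_neg_eq_add] at h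
    rw [← neg_inj, h]
    abel
  obtain rfl | rfl | rfl :=
    (by decide : ∀ r s : Fin 3, s = r ∨ s = r + 1 ∨ s = r + 2) r s
  · rw [hself X hX, HKT.sum_eps_self_smul]
  · rw [HKT.sum_eps_add_one_smul]
    funext x
    rw [hD.lieEndo_of_parallel hJ (hWsmooth r) (hDW r) (r + 1) hX]
    exact hsucc x (X x)
  · rw [HKT.sum_eps_add_two_smul r]
    funext x
    rw [hD.lieEndo_of_parallel hJ (hWsmooth r) (hDW r) (r + 2) hX]
    simp only [HKT.EndoField.app, Pi.neg_apply]
    -- Writing `I_{r+2} = I_r I_{r+1}` and pulling `I_r` out reduces the commutator to `I_r I_{r+2}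
    -- = -I_{r+1}`.
    rw [← hJ.apply_succ r, ← hJ.apply_succ r, hself', ← map_sub, hsucc]
    have h := hJ.succ_apply (r + 2) x (X x)
    rwa [(by decide : ∀ r : Fin 3, r + 2 + 1 = r), (by decide : ∀ r : Fin 3, r + 2 + 2 = r + 1)]
      at h
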